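/- Let $n \ge 0$ and let $\phi_0,\dots,\phi_n$ be polynomials with complex coefficients such that $\deg \phi_j = j$ and $\phi_0 = 1$. Let $\eta_0,\dots,\eta_n$ be independent standard complex normal random variables, that is, each has density $\frac1\pi e^{-|z|^2}$ on $\mathbb C$ with respect to $dx\,dy$, and put $\Phi_n(z)=\sum_{j=0}^n \eta_j\phi_j(z)$. For $z,w\in\mathbb C$ and integers $k,l\ge 0$ let $$K_n(z,w)=\sum_{j=0}^n \phi_j(z)\overline{\phi_j(w)},\qquad K_n^{(k,l)}(z,w)=\sum_{j=0}^n \phi_j^{(k)}(z)\overline{\phi_j^{(l)}(w)}.$$ Then $K_n(z,z)\neq0$ for every $z\in\mathbb C$, and $$\rho_{n,0}(z)=\frac{K_n(z,z)K_n^{(1,1)}(z,z)-\bigl|K_n^{(0,1)}(z,z)\bigr|^2}{\pi K_n(z,z)^2}$$ is real. Let $\Theta\subset\mathbb C$ be a domain (a nonempty connected open set) and let $N_\Theta$ be the number of zeros of $\Phi_n$ in $\Theta$, counted with multiplicity. Then $N_\Theta$ is integrable, $\rho_{n,0}$ is integrable over $\Theta$, and $$\mathbb E[N_\Theta]=\iint_\Theta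 \rho_{n,0}(z)\,dx\,dy .$$ Moreover, if the boundary $\partial\Theta$ is a positively oriented contour, then also $$\mathbb E[N_\Theta]=\frac1{2\pi i}\oint_{\partial\Theta}\frac{\overline{K_n^{(0,1)}(z,z)}}{K_n(z,z)}\,dz .$$ Here $\partial\Theta$ is called a positively oriented contour if there are finitely many closed piecewise continuously differentiable paths $\gamma_1,\dots,\gamma_k$ in $\mathbb C$ whose union of traces is $\partial\Theta$ and whose winding numbers add up to $1$ about each point of $\Theta$ and to $0$ about each point outside $\overline\Theta$; $\oint_{\partial\Theta}$ then means $\sum_{i=1}^k\int_{\gamma_i}$, for any such choice of paths. -/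

import Mathlib

open MeasureTheory ProbabilityTheory Polynomial
open scoped ComplexConjugate

noncomputable section

namespace RandomZeros

/-- The standard complex normal law: the measure on `ℂ` with density `π⁻¹ exp (-|z|²)` with respect
to Lebesgue measure `dx dy` (mean `0`, `E |η|² = 1`, `E η² = 0`). -/
def stdComplexNormal : Measure ℂ :=
  (volume : Measure ℂ).withDensity
    (fun z => ENNReal.ofReal (Real.pi⁻¹ * Real.exp (-‖z‖ ^ 2)))

/-- The polynomial `∑ j, c j * φ j` with coefficients `c j` in the family `φ`. -/
def combination {n : ℕ} (φ : Fin (n + 1) → ℂ[X]) (c : Fin (n + 1) → ℂ) : ℂ[X] :=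
  ∑ j, C (c j) * φ j

open Classical in
/-- The number of zeros of `p` in `Θ`, counted with multiplicity. For the zero polynomial the value
is `0`; for a random polynomial with a nondegenerate normal law this concerns a null event. -/
def zeroCount (p : ℂ[X]) (Θ : Set ℂ) : ℕ :=
  p.roots.countP (fun z => z ∈ Θ)

/-- The kernel `K_n(z, w) = ∑ j, φ_j(z) * conj (φ_j(w))`. -/
def kernel {n : ℕ} (φ : Fin (n + 1) → ℂ[X]) (z w : ℂ) : ℂ :=
  ∑ j, (φ j).eval z * conj ((φ j).eval w)

/-- `K_n^{(k,l)}(z, w) = ∑ j, φ_j^{(k)}(z) * conj (φ_j^{(l)}(w))`. -/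
def kernelDeriv {n : ℕ} (φ : Fin (n + 1) → ℂ[X]) (k l : ℕ) (z w : ℂ) : ℂ :=
  ∑ j, (derivative^[k] (φ j)).eval z * conj ((derivative^[l] (φ j)).eval w)

/-- The density `ρ_{n,0}`, as a real-valued function: the real part of
`(K_n K_n^{(1,1)} - |K_n^{(0,1)}|²) / (π K_n²)` on the diagonal. That this expression is real is
part of the theorem. -/
def zeroDensity {n : ℕ} (φ : Fin (n + 1) → ℂ[X]) (z : ℂ) : ℝ :=
  ((kernel φ z z * kernelDeriv φ 1 1 z z - ((‖kernelDeriv φ 0 1 z z‖ ^ 2 : ℝ) : ℂ)) /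
    ((Real.pi : ℂ) * kernel φ z z ^ 2)).re

/-- A closed path: a closed, piecewise continuously differentiable curve
`[t 0, t m] → ℂ` with break points `t 0 ≤ t 1 ≤ ⋯ ≤ t m`. It is continuously differentiable on each
closed piece (one-sided derivatives at its ends), hence continuous on `[t 0, t m]`. -/
structure ClosedPath where
  toFun : ℝ → ℂ
  m : ℕ
  t : ℕ → ℝ
  mono : Monotone t
  contDiffOn : ∀ i < m, ContDiffOn ℝ 1 toFun (Set.Icc (t i) (t (i + 1)))
  closed : toFun (t 0) = toFun (t m)

namespace ClosedPath

/-- The set of points on the path. -/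
def trace (γ : ClosedPath) : Set ℂ :=
  γ.toFun '' Set.Icc (γ.t 0) (γ.t γ.m)

/-- The contour integral `∮_γ f(z) dz`. -/
def contourIntegral (γ : ClosedPath) (f : ℂ → ℂ) : ℂ :=
  ∫ s in (γ.t 0)..(γ.t γ.m), f (γ.toFun s) * deriv γ.toFun s

/-- The index (winding number) of the path about a point off the path. -/
def index (γ : ClosedPath) (a : ℂ) : ℂ :=
  (2 * Real.pi * Complex.I)⁻¹ * γ.contourIntegral (fun z => (z - a)⁻¹)

end ClosedPath

/-- The cycle `γ 0 + ⋯ + γ (k - 1)` is the positively oriented boundary of `Θ`: it runs through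
exactly the points of `∂Θ`, and its index is `1` about each point of `Θ` and `0` about each point
outside the closure of `Θ`. -/
structure IsPositiveBoundary {k : ℕ} (γ : Fin k → ClosedPath) (Θ : Set ℂ) : Prop where
  trace_eq : ⋃ i, (γ i).trace = frontier Θ
  index_inside : ∀ a ∈ Θ, ∑ i, (γ i).index a = 1
  index_outside : ∀ a ∉ closure Θ, ∑ i, (γ i).index a = 0

end RandomZeros

end

namespace RandomZeros

open Set Filter Topology ENNReal

/-! ### The complex normal law -/

/-! Everything rests on the mean of the logarithmic derivative `Φ'(z)/Φ(z)`, which equals `m(z) =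
conj K^{(0,1)}(z,z) / K(z,z)` (`integral_logDerivAt`). This follows from a symmetry: reflecting the
coefficient vector in the complex line spanned by `conj φ_j(z)` preserves the Gaussian law, fixes
`Φ(z)` and replaces `Φ'(z)/Φ(z)` by `2m(z) - Φ'(z)/Φ(z)`.

A curve that is a null set almost surely meets no zero of `Φ`, so the argument principle counts
zeros by integrating `Φ'/Φ`. Fubini puts the mean inside and gives the contour formula. Since `φ_0 =
1`, the first coefficient only translates `Φ(z)`, and `1/|η + w|` has a mean bounded uniformly in
`w`; this yields both the avoidance of curves and the integrability for Fubini.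

The boundary of `Θ` may be arbitrarily bad, so the area formula is proved first for rectangles, by
Green's theorem and `∂m/∂z̄ = π ρ` (`dbar_meanLogDeriv`). It extends to all Borel sets by a π-λ
argument, with finiteness from the bound `n` on the number of zeros (`hasZeroDensity`). -/

theorem integrable_exp_neg_mul_norm_sq {b : ℝ} (hb : 0 < b) :
    Integrable (fun z : ℂ => Real.exp (-b * ‖z‖ ^ 2)) := by
  -- The Bochner integral of a non-integrable function is `0` by convention, so a nonzero value
  -- proves integrability.
  refine Integrable.of_integral_ne_zero ?_
  rw [GaussianFourier.integral_rexp_neg_mul_sq_norm hb]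
  have : 0 < Real.pi / b := by positivity
  positivity

theorem measurable_stdComplexNormal_density :
    Measurable (fun z : ℂ => ENNReal.ofReal (Real.pi⁻¹ * Real.exp (-‖z‖ ^ 2))) := by
  fun_prop

instance isProbabilityMeasure_stdComplexNormal : IsProbabilityMeasure stdComplexNormal := by
  refine ⟨?_⟩
  have hint : Integrable (fun z : ℂ => Real.pi⁻¹ * Real.exp (-‖z‖ ^ 2)) := by
    simpa using (integrable_exp_neg_mul_norm_sq one_pos).const_mul Real.pi⁻¹
  rw [stdComplexNormal, withDensity_apply _ MeasurableSet.univ, Measure.restrict_univ,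
    ← ofReal_integral_eq_lintegral_ofReal hint (Eventually.of_forall fun z => by positivity),
    integral_const_mul]
  have := GaussianFourier.integral_rexp_neg_mul_sq_norm (V := ℂ) one_pos
  simp only [neg_mul, one_mul, div_one, Complex.finrank_real_complex] at this
  rw [this]
  simp [Real.pi_ne_zero]

theorem stdComplexNormal_absolutelyContinuous : stdComplexNormal ≪ volume :=
  withDensity_absolutelyContinuous _ _

theorem stdComplexNormal_le_volume : stdComplexNormal ≤ volume := by
  refine Measure.le_iff.2 fun s hs => ?_
  rw [stdComplexNormal, withDensity_apply _ hs]
  calc ∫⁻ z in s, ENNReal.ofReal (Real.pi⁻¹ * Real.exp (-‖z‖ ^ 2))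
      ≤ ∫⁻ z in s, 1 := by
        refine lintegral_mono fun z => ?_
        rw [← ENNReal.ofReal_one]
        refine ENNReal.ofReal_le_ofReal (mul_le_one₀ ?_ (by positivity) ?_)
        · exact inv_le_one_of_one_le₀ (by linarith [Real.pi_gt_three])
        · exact Real.exp_le_one_iff.2 (by nlinarith [sq_nonneg ‖z‖])
    _ = volume s := by simp

/-- The first absolute moment of the standard complex normal law is finite. -/
theorem lintegral_enorm_stdComplexNormal_lt_top : ∫⁻ z, ‖z‖ₑ ∂stdComplexNormal < ∞ := by
  rw [stdComplexNormal, lintegral_withDensity_eq_lintegral_mul _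
    measurable_stdComplexNormal_density measurable_enorm]
  refine lt_of_le_of_lt (lintegral_mono (g := fun z : ℂ =>
    ENNReal.ofReal (Real.exp (-(1 / 2) * ‖z‖ ^ 2))) fun z => ?_)
    (integrable_exp_neg_mul_norm_sq (by norm_num : (0 : ℝ) < 1 / 2)).lintegral_lt_top
  rw [Pi.mul_apply, ← ofReal_norm, ← ENNReal.ofReal_mul (by positivity)]
  refine ENNReal.ofReal_le_ofReal ?_
  -- Half of the Gaussian exponent absorbs the factor `‖z‖`.
  have h1 : ‖z‖ ≤ Real.exp (1 / 2 * ‖z‖ ^ 2) :=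
    le_trans (by nlinarith [sq_nonneg (‖z‖ - 1)]) (Real.add_one_le_exp _)
  have h2 : Real.pi⁻¹ ≤ 1 := inv_le_one_of_one_le₀ (by linarith [Real.pi_gt_three])
  calc Real.pi⁻¹ * Real.exp (-‖z‖ ^ 2) * ‖z‖
      ≤ 1 * Real.exp (-‖z‖ ^ 2) * Real.exp (1 / 2 * ‖z‖ ^ 2) := by gcongr
    _ = Real.exp (-(1 / 2) * ‖z‖ ^ 2) := by rw [one_mul, ← Real.exp_add]; ring_nf

/-- In polar coordinates of the plane the Jacobian `r` cancels the singularity `1/r`. -/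
theorem lintegral_ball_enorm_inv_lt_top :
    ∫⁻ z in Metric.ball (0 : ℂ) 1, ‖z⁻¹‖ₑ < ∞ := by
  have h : IntegrableOn (fun z : ℂ => ‖z‖⁻¹) (Metric.ball 0 1) volume := by
    rw [integrableOn_fun_norm_addHaar volume (f := fun r : ℝ => r⁻¹)]
    refine IntegrableOn.congr_fun (f := fun _ : ℝ => (1 : ℝ)) ?_ ?_ measurableSet_Ioo
    · simp
    · intro r hr
      have : r ≠ 0 := hr.1.ne'
      simp [Complex.finrank_real_complex, this]
  have e (z : ℂ) : ‖z⁻¹‖ₑ = ‖(‖z‖⁻¹ : ℝ)‖ₑ := by rw [← norm_inv, enorm_norm]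
  simp_rw [e]
  exact h.2

/-- A bound, uniform in the shift `w`, for the mean of `1 / |η + w|`. -/
noncomputable def inverseMomentBound : ℝ≥0∞ :=
  (∫⁻ z in Metric.ball (0 : ℂ) 1, ‖z⁻¹‖ₑ) + 1

theorem inverseMomentBound_lt_top : inverseMomentBound < ∞ :=
  ENNReal.add_lt_top.2 ⟨lintegral_ball_enorm_inv_lt_top, by simp⟩

/-- Near the pole the law is dominated by Lebesgue measure, whose translation invariance removes
`w`; away from it the integrand is at most `1`. -/
theorem lintegral_enorm_inv_add_le (w : ℂ) :
    ∫⁻ z, ‖(z + w)⁻¹‖ₑ ∂stdComplexNormal ≤ inverseMomentBound := by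
  have hm : MeasurableSet {z : ℂ | ‖z + w‖ < 1} := by measurability
  rw [← lintegral_add_compl _ hm]
  refine add_le_add ?_ ?_
  · calc ∫⁻ z in {z : ℂ | ‖z + w‖ < 1}, ‖(z + w)⁻¹‖ₑ ∂stdComplexNormal
        ≤ ∫⁻ z in {z : ℂ | ‖z + w‖ < 1}, ‖(z + w)⁻¹‖ₑ :=
          lintegral_mono' (Measure.restrict_mono le_rfl stdComplexNormal_le_volume) le_rfl
      _ = ∫⁻ z in (fun z => z + w) ⁻¹' Metric.ball 0 1, ‖(z + w)⁻¹‖ₑ := by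
          congr 2; ext z; simp only [mem_preimage, mem_ball_zero_iff]; rfl
      _ = ∫⁻ z in Metric.ball (0 : ℂ) 1, ‖z⁻¹‖ₑ :=
          (measurePreserving_add_right volume w).setLIntegral_comp_preimage
            measurableSet_ball (f := fun z => ‖z⁻¹‖ₑ) (by fun_prop)
  · calc ∫⁻ z in {z : ℂ | ‖z + w‖ < 1}ᶜ, ‖(z + w)⁻¹‖ₑ ∂stdComplexNormal
        ≤ ∫⁻ z in {z : ℂ | ‖z + w‖ < 1}ᶜ, 1 ∂stdComplexNormal := by
          refine setLIntegral_mono' hm.compl fun z hz => ?_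
          simp only [mem_compl_iff, mem_ofPred_eq, not_lt] at hz
          rw [← ofReal_norm, ← ENNReal.ofReal_one, norm_inv]
          exact ENNReal.ofReal_le_ofReal (inv_le_one_of_one_le₀ hz)
      _ ≤ 1 := by simpa using prob_le_one

/-! ### The law of the coefficients -/

/-- The joint law of `m` independent standard complex normal variables. -/
noncomputable def coeffLaw (m : ℕ) : Measure (Fin m → ℂ) :=
  Measure.pi fun _ => stdComplexNormal

instance (m : ℕ) : IsProbabilityMeasure (coeffLaw m) := by
  unfold coeffLaw; infer_instance

/-- Integration over the first coefficient, then over the remaining ones. -/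
theorem lintegral_coeffLaw_succ {m : ℕ} {f : (Fin (m + 1) → ℂ) → ℝ≥0∞} (hf : Measurable f) :
    ∫⁻ c, f c ∂coeffLaw (m + 1) =
      ∫⁻ y, ∫⁻ x, f (Fin.cons x y) ∂stdComplexNormal ∂coeffLaw m := by
  have h := (measurePreserving_piFinSuccAbove (fun _ : Fin (m + 1) => stdComplexNormal) 0).symm
  have := h.lintegral_comp hf
  rw [coeffLaw, ← this]
  refine (lintegral_prod_symm' (μ := stdComplexNormal) (ν := coeffLaw m) _
    (hf.comp h.measurable)).trans ?_
  refine lintegral_congr fun y => lintegral_congr fun x => congrArg f ?_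
  exact Fin.insertNth_zero' x y

theorem lintegral_enorm_coord_coeffLaw {m : ℕ} (j : Fin m) :
    ∫⁻ c, ‖c j‖ₑ ∂coeffLaw m = ∫⁻ z, ‖z‖ₑ ∂stdComplexNormal :=
  (measurePreserving_eval (fun _ : Fin m => stdComplexNormal) j).lintegral_comp
    (f := fun z => ‖z‖ₑ) measurable_enorm

/-- Makes visible that the law depends on `c` only through `∑ |c j|²`, the source of its symmetries.
-/
theorem coeffLaw_eq_withDensity (m : ℕ) :
    coeffLaw m = (volume : Measure (Fin m → ℂ)).withDensity
      (fun c => ∏ j, ENNReal.ofReal (Real.pi⁻¹ * Real.exp (-‖c j‖ ^ 2))) := by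
  induction m with
  | zero =>
    simp only [Finset.univ_eq_empty, Finset.prod_empty]
    rw [coeffLaw, volume_pi, Measure.pi_of_empty, Measure.pi_of_empty]
    exact withDensity_one.symm
  | succ m ih =>
    have h := (measurePreserving_piFinSuccAbove (fun _ : Fin (m + 1) => stdComplexNormal) 0).symm
    have h' := (volume_preserving_piFinSuccAbove (fun _ : Fin (m + 1) => ℂ) 0).symm
    refine Measure.ext fun s hs => ?_
    have hd : Measurable fun c : Fin (m + 1) → ℂ =>
      ∏ j, ENNReal.ofReal (Real.pi⁻¹ * Real.exp (-‖c j‖ ^ 2)) := by fun_prop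
    have hd' : Measurable fun c : Fin m → ℂ =>
      ∏ j, ENNReal.ofReal (Real.pi⁻¹ * Real.exp (-‖c j‖ ^ 2)) := by fun_prop
    rw [withDensity_apply _ hs, ← h'.setLIntegral_comp_preimage hs hd, coeffLaw,
      ← h.measure_preimage hs.nullMeasurableSet]
    change (stdComplexNormal.prod (coeffLaw m)) _ = _
    rw [ih, stdComplexNormal, prod_withDensity measurable_stdComplexNormal_density hd',
      withDensity_apply _ (h.measurable hs)]
    refine lintegral_congr fun p => ?_
    rw [Fin.prod_univ_succ]
    rfl

/-- An involutive linear map preserving `∑ |c j|²` preserves the law of the coefficients. -/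
theorem measurePreserving_coeffLaw {m : ℕ} (T : (Fin m → ℂ) →ₗ[ℝ] (Fin m → ℂ))
    (hT : ∀ c, T (T c) = c) (hnorm : ∀ c, ∑ j, ‖T c j‖ ^ 2 = ∑ j, ‖c j‖ ^ 2) :
    MeasurePreserving T (coeffLaw m) (coeffLaw m) := by
  have hTm : Measurable T := T.continuous_of_finiteDimensional.measurable
  -- `T² = 1` forces `det T = ±1`, so Lebesgue measure is preserved; the density is preserved by
  -- `hnorm`.
  have hdet : |LinearMap.det T| = 1 := by
    have h1 : LinearMap.det T * LinearMap.det T = 1 := by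
      rw [← LinearMap.det_comp, show T ∘ₗ T = LinearMap.id from LinearMap.ext hT,
        LinearMap.det_id]
    have h2 : |LinearMap.det T| * |LinearMap.det T| = 1 := by rw [← abs_mul, h1, abs_one]
    nlinarith [abs_nonneg (LinearMap.det T)]
  have hdet0 : LinearMap.det T ≠ 0 := fun h => by simp [h] at hdet
  have hvol : MeasurePreserving T (volume : Measure (Fin m → ℂ)) volume := by
    refine ⟨hTm, ?_⟩
    rw [Measure.map_linearMap_addHaar_eq_smul_addHaar _ hdet0, abs_inv, hdet]
    simp
  have hdens (c : Fin m → ℂ) : ∏ j, ENNReal.ofReal (Real.pi⁻¹ * Real.exp (-‖c j‖ ^ 2)) =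
      ENNReal.ofReal (Real.pi⁻¹ ^ m * Real.exp (-∑ j, ‖c j‖ ^ 2)) := by
    rw [← ENNReal.ofReal_prod_of_nonneg fun j _ => by positivity, Finset.prod_mul_distrib,
      ← Real.exp_sum]
    simp
  refine ⟨hTm, Measure.ext fun s hs => ?_⟩
  rw [Measure.map_apply hTm hs, coeffLaw_eq_withDensity, withDensity_apply _ hs,
    withDensity_apply _ (hTm hs), ← hvol.setLIntegral_comp_preimage hs (by fun_prop)]
  simp only [hdens, hnorm]

/-! ### The logarithmic derivative of the random polynomial -/

variable {n : ℕ} (φ : Fin (n + 1) → ℂ[X])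

theorem eval_combination (c : Fin (n + 1) → ℂ) (z : ℂ) :
    (combination φ c).eval z = ∑ j, c j * (φ j).eval z := by
  simp [combination, eval_finsetSum]

theorem eval_derivative_combination (c : Fin (n + 1) → ℂ) (z : ℂ) :
    (derivative (combination φ c)).eval z = ∑ j, c j * (derivative (φ j)).eval z := by
  simp [combination, eval_finsetSum]

/-- The logarithmic derivative at `z` of the polynomial with coefficients `c` in the family `φ`. -/
noncomputable def logDerivAt (c : Fin (n + 1) → ℂ) (z : ℂ) : ℂ :=
  (derivative (combination φ c)).eval z / (combination φ c).eval z

theorem measurable_logDerivAt :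
    Measurable fun p : (Fin (n + 1) → ℂ) × ℂ => logDerivAt φ p.1 p.2 := by
  simp only [logDerivAt, eval_combination, eval_derivative_combination]
  fun_prop

/-- Projection along a compact factor is a closed map. This gives measurability of the exceptional
event. -/
theorem isClosed_exists_eval_eq_zero {T : Set ℂ} (hT : IsCompact T) :
    IsClosed {c : Fin (n + 1) → ℂ | ∃ z ∈ T, (combination φ c).eval z = 0} := by
  have : CompactSpace T := isCompact_iff_compactSpace.1 hT
  have h : IsClosed {p : T × (Fin (n + 1) → ℂ) | (combination φ p.2).eval (p.1 : ℂ) = 0} := by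
    refine isClosed_eq ?_ continuous_const
    simp only [eval_combination]
    fun_prop
  convert isClosedMap_snd_of_compactSpace _ h using 1
  ext c
  simp

/-- Almost surely, the random polynomial has no zero in a given compact null set. -/
theorem ae_forall_eval_ne_zero (hφ0 : φ 0 = 1) {T : Set ℂ} (hT : IsCompact T)
    (hT0 : volume T = 0) :
    ∀ᵐ c ∂coeffLaw (n + 1), ∀ z ∈ T, (combination φ c).eval z ≠ 0 := by
  have hS := (isClosed_exists_eval_eq_zero φ hT).measurableSet
  set S := {c : Fin (n + 1) → ℂ | ∃ z ∈ T, (combination φ c).eval z = 0} with hSdef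
  suffices h : coeffLaw (n + 1) S = 0 by
    filter_upwards [measure_eq_zero_iff_ae_notMem.1 h] with c hc z hz h0
    exact hc ⟨z, hz, h0⟩
  rw [← lintegral_indicator_one hS, lintegral_coeffLaw_succ (measurable_one.indicator hS)]
  refine (lintegral_congr fun y => ?_).trans lintegral_zero
  have hslice (x : ℂ) : S.indicator (1 : (Fin (n + 1) → ℂ) → ℝ≥0∞) (Fin.cons x y) =
      ({x | (Fin.cons x y : Fin (n + 1) → ℂ) ∈ S}).indicator 1 x := rfl
  have hmeas : MeasurableSet {x : ℂ | (Fin.cons x y : Fin (n + 1) → ℂ) ∈ S} := by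
    have : Continuous fun x : ℂ => (Fin.cons x y : Fin (n + 1) → ℂ) :=
      continuous_pi fun i => by refine Fin.cases ?_ (fun i => ?_) i <;> simp <;> fun_prop
    exact this.measurable hS
  simp_rw [hslice]
  rw [lintegral_indicator_one hmeas]
  refine stdComplexNormal_absolutelyContinuous ?_
  -- With the other coefficients fixed, `φ 0 = 1` lets the equation be solved for the first one: the
  -- bad values are the image of the null set `T` under a polynomial.
  have himage : {x : ℂ | (Fin.cons x y : Fin (n + 1) → ℂ) ∈ S} =
      (fun z => -∑ j : Fin n, y j * (φ j.succ).eval z) '' T := by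
    ext x
    simp only [hSdef, mem_ofPred_eq, eval_combination, Fin.sum_univ_succ, Fin.cons_zero,
      Fin.cons_succ, hφ0, eval_one, mul_one, mem_image]
    refine exists_congr fun z => and_congr_right fun _ => ?_
    constructor <;> intro h <;> linear_combination -h
  rw [himage]
  refine addHaar_image_eq_zero_of_differentiableOn_of_addHaar_eq_zero volume ?_ hT0
  have h : Differentiable ℂ fun z => -∑ j : Fin n, y j * (φ j.succ).eval z := by fun_prop
  exact (h.restrictScalars ℝ).differentiableOn

theorem ae_eval_ne_zero (hφ0 : φ 0 = 1) (z : ℂ) :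
    ∀ᵐ c ∂coeffLaw (n + 1), (combination φ c).eval z ≠ 0 := by
  filter_upwards [ae_forall_eval_ne_zero φ hφ0 (isCompact_singleton (x := z)) (by simp)]
    with c hc using hc z rfl

/-- The mean of the modulus of the logarithmic derivative is locally bounded. -/
theorem lintegral_enorm_logDerivAt_le (hφ0 : φ 0 = 1) (z : ℂ) :
    ∫⁻ c, ‖logDerivAt φ c z‖ₑ ∂coeffLaw (n + 1) ≤
      inverseMomentBound * (∫⁻ z, ‖z‖ₑ ∂stdComplexNormal) *
        ∑ j : Fin n, ‖(derivative (φ j.succ)).eval z‖ₑ := by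
  have hm : Measurable fun c => ‖logDerivAt φ c z‖ₑ :=
    ((measurable_logDerivAt φ).comp (measurable_id.prodMk measurable_const)).enorm
  rw [lintegral_coeffLaw_succ hm]
  calc ∫⁻ y, ∫⁻ x, ‖logDerivAt φ (Fin.cons x y) z‖ₑ ∂stdComplexNormal ∂coeffLaw n
      ≤ ∫⁻ y, inverseMomentBound *
          ∑ j : Fin n, ‖y j‖ₑ * ‖(derivative (φ j.succ)).eval z‖ₑ ∂coeffLaw n := by
        refine lintegral_mono fun y => ?_
        -- As `φ 0 = 1` has zero derivative, `x` enters the denominator only.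
        have h (x : ℂ) : ‖logDerivAt φ (Fin.cons x y) z‖ₑ =
            ‖∑ j : Fin n, y j * (derivative (φ j.succ)).eval z‖ₑ *
              ‖(x + ∑ j : Fin n, y j * (φ j.succ).eval z)⁻¹‖ₑ := by
          simp [logDerivAt, eval_combination, eval_derivative_combination, Fin.sum_univ_succ,
            hφ0, div_eq_mul_inv, enorm_mul]
        simp_rw [h]
        rw [lintegral_const_mul _ (by fun_prop), mul_comm]
        refine mul_le_mul' (lintegral_enorm_inv_add_le _) 
          ((enorm_sum_le Finset.univ _).trans_eq ?_)
        simp [enorm_mul]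
    _ = _ := by
        rw [lintegral_const_mul _ (by fun_prop), lintegral_finsetSum _ (by fun_prop), mul_assoc]
        congr 1
        rw [Finset.mul_sum]
        refine Finset.sum_congr rfl fun j _ => ?_
        rw [lintegral_mul_const _ (by fun_prop), lintegral_enorm_coord_coeffLaw]

theorem integrable_logDerivAt (hφ0 : φ 0 = 1) (z : ℂ) :
    Integrable (fun c => logDerivAt φ c z) (coeffLaw (n + 1)) := by
  refine ⟨((measurable_logDerivAt φ).comp
    (measurable_id.prodMk measurable_const)).aestronglyMeasurable, ?_⟩
  refine (lintegral_enorm_logDerivAt_le φ hφ0 z).trans_lt ?_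
  refine ENNReal.mul_lt_top (ENNReal.mul_lt_top inverseMomentBound_lt_top
    lintegral_enorm_stdComplexNormal_lt_top) ?_
  exact ENNReal.sum_lt_top.2 fun j _ => enorm_lt_top

/-- The reflection `c ↦ 2 P c - c`, where `P` is the orthogonal projection onto the line spanned by
`conj a`. -/
noncomputable def lineReflection {m : ℕ} (a : Fin m → ℂ) : (Fin m → ℂ) →ₗ[ℝ] (Fin m → ℂ) where
  toFun c j := 2 * (∑ i, c i * a i) / (∑ i, a i * conj (a i)) * conj (a j) - c j
  map_add' c d := by
    ext j
    simp only [Pi.add_apply, add_mul, Finset.sum_add_distrib]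
    ring
  map_smul' r c := by
    ext j
    simp only [Pi.smul_apply, Complex.real_smul, mul_assoc, RingHom.id_apply, ← Finset.mul_sum]
    ring

theorem lineReflection_apply {m : ℕ} (a c : Fin m → ℂ) (j : Fin m) : lineReflection a c j =
    2 * (∑ i, c i * a i) / (∑ i, a i * conj (a i)) * conj (a j) - c j := rfl

theorem sum_lineReflection_mul {m : ℕ} (a b c : Fin m → ℂ) :
    ∑ j, lineReflection a c j * b j =
      2 * (∑ i, c i * a i) / (∑ i, a i * conj (a i)) * (∑ j, b j * conj (a j)) -
        ∑ j, c j * b j := by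
  simp only [lineReflection_apply, sub_mul, Finset.sum_sub_distrib, Finset.mul_sum]
  congr 1
  exact Finset.sum_congr rfl fun j _ => by ring

/-- The functional `c ↦ ∑ c j * a j` vanishes on the orthogonal complement of `conj a`, the only
part on which the reflection changes sign. -/
theorem sum_lineReflection_mul_self {m : ℕ} {a : Fin m → ℂ} (ha : ∑ i, a i * conj (a i) ≠ 0)
    (c : Fin m → ℂ) : ∑ j, lineReflection a c j * a j = ∑ j, c j * a j := by
  rw [sum_lineReflection_mul, div_mul_cancel₀ _ ha]
  ring

theorem measurePreserving_lineReflection {m : ℕ} {a : Fin m → ℂ}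
    (ha : ∑ i, a i * conj (a i) ≠ 0) :
    MeasurePreserving (lineReflection a) (coeffLaw m) (coeffLaw m) := by
  refine measurePreserving_coeffLaw _ (fun c => ?_) fun c => ?_
  · ext j
    rw [lineReflection_apply, sum_lineReflection_mul_self ha, lineReflection_apply]
    ring
  · have key : ∑ j, lineReflection a c j * conj (lineReflection a c j) =
        ∑ j, c j * conj (c j) := by
      set A := ∑ i, a i * conj (a i) with hA
      have hAc : conj A = A := by simp [hA, map_sum, mul_comm]
      set X := ∑ i, c i * a i with hX
      have hXc : conj X = ∑ i, conj (c i) * conj (a i) := by simp [hX, map_sum]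
      have h (j : Fin m) : lineReflection a c j * conj (lineReflection a c j) =
          4 * X * conj X / A ^ 2 * (a j * conj (a j)) -
            2 * X / A * (conj (c j) * conj (a j)) - 2 * conj X / A * (c j * a j) +
            c j * conj (c j) := by
        simp only [lineReflection_apply, ← hA, ← hX, map_sub, map_mul, map_div₀, hAc,
          Complex.conj_conj, map_ofNat]
        field_simp
        ring
      simp only [h, Finset.sum_add_distrib, Finset.sum_sub_distrib, ← Finset.mul_sum, ← hA, ← hX,
        ← hXc]
      field_simp
      ring
    simp only [Complex.mul_conj'] at key
    exact_mod_cast key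

theorem kernel_self (z : ℂ) :
    kernel φ z z = ((∑ j, ‖(φ j).eval z‖ ^ 2 : ℝ) : ℂ) := by
  simp [kernel, Complex.mul_conj']

theorem sum_sq_pos (hφ0 : φ 0 = 1) (z : ℂ) : 0 < ∑ j, ‖(φ j).eval z‖ ^ 2 := by
  refine Finset.sum_pos' (fun j _ => by positivity) ⟨0, Finset.mem_univ _, ?_⟩
  simp [hφ0]

theorem kernel_self_ne_zero (hφ0 : φ 0 = 1) (z : ℂ) : kernel φ z z ≠ 0 := by
  rw [kernel_self]
  exact_mod_cast (sum_sq_pos φ hφ0 z).ne'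

/-- The mean of the logarithmic derivative of the random polynomial. -/
noncomputable def meanLogDeriv (z : ℂ) : ℂ :=
  conj (kernelDeriv φ 0 1 z z) / kernel φ z z

/-- The reflection with `a j = φ_j(z)` turns the integrand `L` into `2m - L` almost surely and
preserves its mean, so `E L = 2m - E L`. -/
theorem integral_logDerivAt (hφ0 : φ 0 = 1) (z : ℂ) :
    ∫ c, logDerivAt φ c z ∂coeffLaw (n + 1) = meanLogDeriv φ z := by
  set a : Fin (n + 1) → ℂ := fun j => (φ j).eval z with ha_def
  have ha : ∑ i, a i * conj (a i) ≠ 0 := kernel_self_ne_zero φ hφ0 z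
  have hmp := measurePreserving_lineReflection ha
  have hm : Measurable fun c => logDerivAt φ c z :=
    (measurable_logDerivAt φ).comp (measurable_id.prodMk measurable_const)
  have h1 : ∫ c, logDerivAt φ (lineReflection a c) z ∂coeffLaw (n + 1) =
      ∫ c, logDerivAt φ c z ∂coeffLaw (n + 1) := by
    conv_rhs => rw [← hmp.map_eq]
    rw [integral_map hmp.measurable.aemeasurable hm.aestronglyMeasurable]
  have h2 : ∫ c, logDerivAt φ (lineReflection a c) z ∂coeffLaw (n + 1) =
      ∫ c, (2 * meanLogDeriv φ z - logDerivAt φ c z) ∂coeffLaw (n + 1) := by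
    refine integral_congr_ae ?_
    filter_upwards [ae_eval_ne_zero φ hφ0 z] with c hc
    rw [eval_combination] at hc
    simp only [logDerivAt, eval_combination, eval_derivative_combination]
    rw [sum_lineReflection_mul_self ha,
      sum_lineReflection_mul a (fun j => (derivative (φ j)).eval z)]
    have hb : ∑ j, (derivative (φ j)).eval z * conj (a j) = conj (kernelDeriv φ 0 1 z z) := by
      simp [kernelDeriv, map_sum, ha_def, mul_comm]
    have hA : ∑ i, a i * conj (a i) = kernel φ z z := rfl
    have hK := kernel_self_ne_zero φ hφ0 z
    have hX : ∑ i, c i * a i = ∑ j, c j * eval z (φ j) := rfl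
    rw [hb, hA, meanLogDeriv, hX]
    field_simp
  rw [integral_sub (integrable_const _) (integrable_logDerivAt φ hφ0 z)] at h2
  simp only [integral_const, probReal_univ, one_smul] at h2
  linear_combination (1 / 2 : ℂ) * (h2 - h1)

/-! ### Counting zeros by contour integrals -/

/-- The image of an interval under a differentiable curve in the plane is a null set. -/
theorem volume_image_Icc_eq_zero {γ : ℝ → ℂ} {a b : ℝ} (hγ : DifferentiableOn ℝ γ (Icc a b)) :
    volume (γ '' Icc a b) = 0 := by
  -- Precomposing with `re` makes the curve a map from the plane to itself, to be applied to a null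
  -- segment of the real axis.
  have himage : γ '' Icc a b = (fun z : ℂ => γ z.re) '' (Icc a b ×ℂ {0}) := by
    ext w
    constructor
    · rintro ⟨s, hs, rfl⟩
      exact ⟨(s : ℂ), by simpa [Complex.mem_reProdIm] using hs, by simp⟩
    · rintro ⟨z, hz, rfl⟩
      exact ⟨z.re, hz.1, rfl⟩
  rw [himage]
  refine addHaar_image_eq_zero_of_differentiableOn_of_addHaar_eq_zero volume ?_ ?_
  · exact hγ.comp (f := Complex.re) Complex.reCLM.differentiableOn fun z hz => hz.1
  · refine measure_mono_null (t := Complex.imLm ⁻¹' {0}) (fun z hz => hz.2) ?_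
    have h : Complex.imLm ⁻¹' {0} = (LinearMap.ker Complex.imLm : Set ℂ) := rfl
    rw [h]
    refine Measure.addHaar_submodule volume _ fun htop => ?_
    have : Complex.I ∈ LinearMap.ker Complex.imLm := by rw [htop]; trivial
    simp at this

/-- Tonelli, coefficients first: the inner mean is bounded by a continuous function of `γ s`, hence
by a constant on the compact interval. -/
theorem integrable_logDerivAt_mul (hφ0 : φ 0 = 1) {a b : ℝ} {γ w : ℝ → ℂ}
    (hγ : ContinuousOn γ (Icc a b)) (hw : IntegrableOn w (Ioc a b)) :
    Integrable (fun p : (Fin (n + 1) → ℂ) × ℝ => logDerivAt φ p.1 (γ p.2) * w p.2)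
      ((coeffLaw (n + 1)).prod (volume.restrict (Ioc a b))) := by
  have hγm : AEMeasurable γ (volume.restrict (Ioc a b)) :=
    (hγ.mono Ioc_subset_Icc_self).aemeasurable measurableSet_Ioc
  have hm : AEStronglyMeasurable
      (fun p : (Fin (n + 1) → ℂ) × ℝ => logDerivAt φ p.1 (γ p.2) * w p.2)
      ((coeffLaw (n + 1)).prod (volume.restrict (Ioc a b))) := by
    refine AEStronglyMeasurable.mul ?_ hw.aestronglyMeasurable.comp_snd
    exact ((measurable_logDerivAt φ).comp_aemeasurable
      (measurable_fst.aemeasurable.prodMk hγm.comp_snd)).aestronglyMeasurable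
  have hcont : ContinuousOn (fun s => ∑ j : Fin n, ‖(derivative (φ j.succ)).eval (γ s)‖)
      (Icc a b) := by fun_prop
  obtain ⟨B, hB⟩ := (isCompact_Icc.image_of_continuousOn hcont).bddAbove
  refine ⟨hm, ?_⟩
  rw [HasFiniteIntegral, lintegral_prod_symm _ hm.enorm]
  set C := inverseMomentBound * (∫⁻ z, ‖z‖ₑ ∂stdComplexNormal) with hC
  have hCtop : C < ∞ :=
    ENNReal.mul_lt_top inverseMomentBound_lt_top lintegral_enorm_stdComplexNormal_lt_top
  refine lt_of_le_of_lt (b := ∫⁻ s in Ioc a b, C * ENNReal.ofReal B * ‖w s‖ₑ) ?_ ?_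
  · refine setLIntegral_mono_ae' measurableSet_Ioc (Eventually.of_forall fun s hs => ?_)
    simp only [enorm_mul]
    rw [lintegral_mul_const' _ _ enorm_ne_top]
    gcongr
    refine (lintegral_enorm_logDerivAt_le φ hφ0 (γ s)).trans ?_
    gcongr
    have := hB (mem_image_of_mem _ (Ioc_subset_Icc_self hs))
    simp only [← ofReal_norm]
    rw [← ENNReal.ofReal_sum_of_nonneg fun j _ => norm_nonneg _]
    exact ENNReal.ofReal_le_ofReal this
  · rw [lintegral_const_mul' _ _ (ENNReal.mul_lt_top hCtop ofReal_lt_top).ne]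
    exact ENNReal.mul_lt_top (ENNReal.mul_lt_top hCtop ofReal_lt_top) hw.2

/-- Fubini's theorem for the logarithmic derivative along a curve. -/
theorem integral_integral_logDerivAt_mul (hφ0 : φ 0 = 1) {a b : ℝ} (hab : a ≤ b) {γ w : ℝ → ℂ}
    (hγ : ContinuousOn γ (Icc a b)) (hw : IntegrableOn w (Ioc a b)) :
    ∫ c, (∫ s in a..b, logDerivAt φ c (γ s) * w s) ∂coeffLaw (n + 1) =
      ∫ s in a..b, meanLogDeriv φ (γ s) * w s := by
  simp only [intervalIntegral.integral_of_le hab]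
  rw [integral_integral_swap (integrable_logDerivAt_mul φ hφ0 hγ hw)]
  refine integral_congr_ae (Eventually.of_forall fun s => ?_)
  simp only [integral_mul_const, integral_logDerivAt φ hφ0]

theorem integrable_integral_logDerivAt_mul (hφ0 : φ 0 = 1) {a b : ℝ} (hab : a ≤ b)
    {γ w : ℝ → ℂ} (hγ : ContinuousOn γ (Icc a b)) (hw : IntegrableOn w (Ioc a b)) :
    Integrable (fun c => ∫ s in a..b, logDerivAt φ c (γ s) * w s) (coeffLaw (n + 1)) := by
  simp only [intervalIntegral.integral_of_le hab]
  exact (integrable_logDerivAt_mul φ hφ0 hγ hw).integral_prod_left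

/-- The argument principle for a polynomial without zeros on the curve. -/
theorem integral_derivative_div_mul (p : ℂ[X]) {a b : ℝ} (hab : a ≤ b) {γ w : ℝ → ℂ}
    (hγ : ContinuousOn γ (Icc a b)) (hw : IntegrableOn w (Ioc a b))
    (hp : ∀ s ∈ Icc a b, p.eval (γ s) ≠ 0) :
    ∫ s in a..b, (derivative p).eval (γ s) / p.eval (γ s) * w s =
      (p.roots.map fun r => ∫ s in a..b, (γ s - r)⁻¹ * w s).sum := by
  by_cases hp0 : p = 0
  · exact absurd (by simp [hp0]) (hp a ⟨le_rfl, hab⟩)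
  have h1 : ∫ s in a..b, (derivative p).eval (γ s) / p.eval (γ s) * w s =
      ∫ s in a..b, (p.roots.map fun r => (γ s - r)⁻¹ * w s).sum := by
    refine intervalIntegral.integral_congr fun s hs => ?_
    rw [uIcc_of_le hab] at hs
    simp only [(IsAlgClosed.splits p).eval_derivative_div_eval_of_ne_zero (hp s hs), one_div,
      Multiset.sum_map_mul_right]
  rw [h1]
  have hne (r : ℂ) (hr : r ∈ p.roots) (s : ℝ) (hs : s ∈ Icc a b) : γ s - r ≠ 0 := fun h =>
    hp s hs (by rw [sub_eq_zero.1 h]; exact (mem_roots hp0).1 hr)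
  have hint (r : ℂ) (hr : r ∈ p.roots) :
      IntervalIntegrable (fun s => (γ s - r)⁻¹ * w s) volume a b := by
    refine ((intervalIntegrable_iff_integrableOn_Ioc_of_le hab).2 hw).continuousOn_mul ?_
    rw [uIcc_of_le hab]
    exact (hγ.sub continuousOn_const).inv₀ (hne r hr)
  generalize p.roots = R at hint
  clear * - hint
  induction R using Multiset.induction_on with
  | empty => simp
  | cons r R ih =>
    have hR (q : ℂ) (hq : q ∈ R) := hint q (Multiset.mem_cons_of_mem hq)
    have hsum : IntervalIntegrable (fun s => (R.map fun r => (γ s - r)⁻¹ * w s).sum)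
        volume a b := by
      clear ih hint
      induction R using Multiset.induction_on with
      | empty => simp
      | cons q R ih =>
        simp only [Multiset.map_cons, Multiset.sum_cons]
        exact (hR q (Multiset.mem_cons_self q R)).add
          (ih fun u hu => hR u (Multiset.mem_cons_of_mem hu))
    simp only [Multiset.map_cons, Multiset.sum_cons]
    rw [intervalIntegral.integral_add (hint r (Multiset.mem_cons_self r R)) hsum, ih hR]

theorem zeroCount_eq_sum (p : ℂ[X]) (Θ : Set ℂ) :
    (zeroCount p Θ : ℂ) = (p.roots.map (Θ.indicator 1)).sum := by
  classical
  unfold zeroCount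
  induction p.roots using Multiset.induction_on with
  | empty => simp
  | cons r R ih =>
    by_cases hr : r ∈ Θ
    · simp only [Multiset.countP_cons_of_pos _ hr, Multiset.map_cons, Multiset.sum_cons,
        indicator_of_mem hr, ← ih]
      simp [add_comm]
    · simp only [Multiset.countP_cons_of_neg _ hr, Multiset.map_cons, Multiset.sum_cons,
        indicator_of_notMem hr, ← ih]
      simp

/-- A finite family of curves, with weights in place of the derivatives, counts the points of `Θ`
if it covers a compact null set off which its index is the indicator function of `Θ`. -/
structure CountsPoints {ι : Type*} [Fintype ι] (a b : ι → ℝ) (γ w : ι → ℝ → ℂ) (Θ : Set ℂ) :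
    Prop where
  le : ∀ i, a i ≤ b i
  continuousOn : ∀ i, ContinuousOn (γ i) (Icc (a i) (b i))
  integrableOn : ∀ i, IntegrableOn (w i) (Ioc (a i) (b i))
  null : ∀ i, volume (γ i '' Icc (a i) (b i)) = 0
  index : ∀ r ∉ ⋃ i, γ i '' Icc (a i) (b i),
    ∑ i, ∫ s in a i..b i, (γ i s - r)⁻¹ * w i s = 2 * Real.pi * Complex.I * Θ.indicator 1 r

namespace CountsPoints

variable {ι : Type*} [Fintype ι] {a b : ι → ℝ} {γ w : ι → ℝ → ℂ} {Θ : Set ℂ}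

/-- Almost surely all roots lie off the curves, so the index condition applies to each term of the
partial fractions of `p'/p`. -/
theorem ae_zeroCount_eq (h : CountsPoints a b γ w Θ) (hφ0 : φ 0 = 1) :
    ∀ᵐ c ∂coeffLaw (n + 1), (zeroCount (combination φ c) Θ : ℂ) =
      1 / (2 * Real.pi * Complex.I) *
        ∑ i, ∫ s in a i..b i, logDerivAt φ c (γ i s) * w i s := by
  have hT : IsCompact (⋃ i, γ i '' Icc (a i) (b i)) :=
    isCompact_iUnion fun i => isCompact_Icc.image_of_continuousOn (h.continuousOn i)
  have hT0 : volume (⋃ i, γ i '' Icc (a i) (b i)) = 0 := measure_iUnion_null h.null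
  filter_upwards [ae_forall_eval_ne_zero φ hφ0 hT hT0, ae_eval_ne_zero φ hφ0 0] with c hc hc0
  have hp0 : combination φ c ≠ 0 := fun h0 => hc0 (by simp [h0])
  have h1 (i : ι) : ∫ s in a i..b i, logDerivAt φ c (γ i s) * w i s =
      ((combination φ c).roots.map fun r => ∫ s in a i..b i, (γ i s - r)⁻¹ * w i s).sum :=
    integral_derivative_div_mul _ (h.le i) (h.continuousOn i) (h.integrableOn i) fun s hs =>
      hc _ (mem_iUnion.2 ⟨i, mem_image_of_mem _ hs⟩)
  simp only [h1]
  rw [← Multiset.sum_map_sum, Multiset.map_congr rfl fun r hr => h.index r fun hrT =>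
    hc r hrT ((mem_roots hp0).1 hr), Multiset.sum_map_mul_left, ← zeroCount_eq_sum,
    one_div, inv_mul_cancel_left₀ Complex.two_pi_I_ne_zero]

theorem integrable_zeroCount (h : CountsPoints a b γ w Θ) (hφ0 : φ 0 = 1) :
    Integrable (fun c => (zeroCount (combination φ c) Θ : ℂ)) (coeffLaw (n + 1)) := by
  refine Integrable.congr ?_ ((h.ae_zeroCount_eq φ hφ0).mono fun c hc => hc.symm)
  exact (integrable_finsetSum _ fun i _ => integrable_integral_logDerivAt_mul φ hφ0 (h.le i)
    (h.continuousOn i) (h.integrableOn i)).const_mul _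

theorem integral_zeroCount (h : CountsPoints a b γ w Θ) (hφ0 : φ 0 = 1) :
    ∫ c, (zeroCount (combination φ c) Θ : ℂ) ∂coeffLaw (n + 1) =
      1 / (2 * Real.pi * Complex.I) *
        ∑ i, ∫ s in a i..b i, meanLogDeriv φ (γ i s) * w i s := by
  rw [integral_congr_ae (h.ae_zeroCount_eq φ hφ0), integral_const_mul,
    integral_finsetSum _ fun i _ => integrable_integral_logDerivAt_mul φ hφ0 (h.le i)
      (h.continuousOn i) (h.integrableOn i)]
  congr 1
  exact Finset.sum_congr rfl fun i _ => integral_integral_logDerivAt_mul φ hφ0 (h.le i)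
    (h.continuousOn i) (h.integrableOn i)

end CountsPoints

/-! ### Closed paths -/

namespace ClosedPath

variable (γ : ClosedPath)

theorem Icc_succ_eq (i : ℕ) :
    Icc (γ.t 0) (γ.t (i + 1)) = Icc (γ.t 0) (γ.t i) ∪ Icc (γ.t i) (γ.t (i + 1)) :=
  (Icc_union_Icc_eq_Icc (γ.mono (Nat.zero_le i)) (γ.mono (Nat.le_succ i))).symm

theorem continuousOn : ContinuousOn γ.toFun (Icc (γ.t 0) (γ.t γ.m)) := by
  suffices h : ∀ i ≤ γ.m, ContinuousOn γ.toFun (Icc (γ.t 0) (γ.t i)) from h _ le_rfl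
  intro i hi
  induction i with
  | zero => simp
  | succ i ih =>
    rw [γ.Icc_succ_eq]
    exact (ih (by lia)).union_of_isClosed (γ.contDiffOn i (by lia)).continuousOn isClosed_Icc
      isClosed_Icc

theorem volume_trace : volume γ.trace = 0 := by
  suffices h : ∀ i ≤ γ.m, volume (γ.toFun '' Icc (γ.t 0) (γ.t i)) = 0 from h _ le_rfl
  intro i hi
  induction i with
  | zero => simp
  | succ i ih =>
    rw [γ.Icc_succ_eq, image_union]
    exact measure_union_null (ih (by lia))
      (volume_image_Icc_eq_zero ((γ.contDiffOn i (by lia)).differentiableOn one_ne_zero))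

theorem intervalIntegrable_deriv :
    IntervalIntegrable (deriv γ.toFun) volume (γ.t 0) (γ.t γ.m) := by
  refine IntervalIntegrable.trans_iterate fun i hi => ?_
  have hle := γ.mono (Nat.le_succ i)
  -- A one-point piece is set apart because it has no unique one-sided derivative. Elsewhere `deriv`
  -- may differ from the continuous `derivWithin` only at break points, a null set.
  rcases hle.eq_or_lt with heq | hlt
  · rw [Nat.succ_eq_add_one] at heq
    rw [heq]
  rw [intervalIntegrable_iff_integrableOn_Ioo_of_le hle]
  have h : ContinuousOn (derivWithin γ.toFun (Icc (γ.t i) (γ.t (i + 1))))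
      (Icc (γ.t i) (γ.t (i + 1))) :=
    (γ.contDiffOn i hi).continuousOn_derivWithin (uniqueDiffOn_Icc hlt) le_rfl
  refine ((h.integrableOn_Icc (μ := volume)).mono_set Ioo_subset_Icc_self).congr_fun
    (fun s hs => ?_) measurableSet_Ioo
  exact derivWithin_of_mem_nhds (Icc_mem_nhds hs.1 hs.2)

end ClosedPath

theorem IsPositiveBoundary.countsPoints {k : ℕ} {γ : Fin k → ClosedPath} {Θ : Set ℂ}
    (h : IsPositiveBoundary γ Θ) (hΘ : IsOpen Θ) :
    CountsPoints (fun i => (γ i).t 0) (fun i => (γ i).t (γ i).m) (fun i => (γ i).toFun)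
      (fun i => deriv (γ i).toFun) Θ where
  le i := (γ i).mono (Nat.zero_le _)
  continuousOn i := (γ i).continuousOn
  integrableOn i := (intervalIntegrable_iff_integrableOn_Ioc_of_le
    ((γ i).mono (Nat.zero_le _))).1 (γ i).intervalIntegrable_deriv
  null i := (γ i).volume_trace
  index r hr := by
    change r ∉ ⋃ i, (γ i).trace at hr
    have hsum : ∑ i, (γ i).contourIntegral (fun z => (z - r)⁻¹) =
        2 * Real.pi * Complex.I * ∑ i, (γ i).index r := by
      simp only [ClosedPath.index, ← Finset.mul_sum]
      rw [mul_inv_cancel_left₀ Complex.two_pi_I_ne_zero]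
    refine hsum.trans ?_
    rw [h.trace_eq, hΘ.frontier_eq] at hr
    by_cases hrΘ : r ∈ Θ
    · rw [h.index_inside r hrΘ, indicator_of_mem hrΘ, Pi.one_apply]
    · rw [h.index_outside r fun hc => hr ⟨hc, hrΘ⟩, indicator_of_notMem hrΘ]

/-! ### Rectangles -/

/-- A quarter turn from the right half-plane does not cross the branch cut. -/
theorem log_I_mul {q : ℂ} (hq : 0 < q.re) :
    Complex.log (Complex.I * q) = Complex.log q + Real.pi / 2 * Complex.I := by
  have hq0 : q ≠ 0 := fun h => by simp [h] at hq
  have harg := abs_lt.1 (Complex.abs_arg_lt_pi_div_two_iff.2 (Or.inl hq))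
  rw [(Complex.log_mul_eq_add_log_iff Complex.I_ne_zero hq0).2, Complex.log_I, add_comm]
  rw [Complex.arg_I]
  constructor <;> linarith [Real.pi_pos]

/-- The factor `u` rotates the segment into the right half-plane, where the principal logarithm is
an antiderivative. -/
theorem integral_inv_segment {a b : ℝ} (hab : a ≤ b) (p d u : ℂ)
    (h : ∀ s ∈ Icc a b, 0 < (u * (p + s * d)).re) :
    ∫ s in a..b, (p + s * d)⁻¹ * d =
      Complex.log (u * (p + b * d)) - Complex.log (u * (p + a * d)) := by
  have hne (s : ℝ) (hs : s ∈ Icc a b) : u ≠ 0 ∧ p + s * d ≠ 0 := by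
    have h1 := h s hs
    constructor <;> rintro h0 <;> simp [h0] at h1
  rw [intervalIntegral.integral_eq_sub_of_hasDerivAt
    (f := fun s : ℝ => Complex.log (u * (p + s * d)))]
  · intro s hs
    rw [uIcc_of_le hab] at hs
    have h1 : HasDerivAt (fun s : ℝ => u * (p + s * d)) (u * d) s := by
      simpa using (((Complex.ofRealCLM.hasDerivAt (x := s)).mul_const d).const_add p).const_mul u
    convert! h1.clog_real (Or.inl (h s hs)) using 1
    obtain ⟨hu, hp⟩ := hne s hs
    field_simp
  · refine ContinuousOn.intervalIntegrable ?_
    rw [uIcc_of_le hab]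
    exact (ContinuousOn.inv₀ (by fun_prop) fun s hs => (hne s hs).2).mul continuousOn_const

/-- The integral of `f` along the positively oriented boundary of a rectangle. -/
noncomputable def rectIntegral (f : ℂ → ℂ) (x₀ x₁ y₀ y₁ : ℝ) : ℂ :=
  (∫ x : ℝ in x₀..x₁, f (x + y₀ * Complex.I)) - (∫ x : ℝ in x₀..x₁, f (x + y₁ * Complex.I)) +
    Complex.I • (∫ y : ℝ in y₀..y₁, f (x₁ + y * Complex.I)) -
    Complex.I • ∫ y : ℝ in y₀..y₁, f (x₀ + y * Complex.I)

/-- Each side has its own rotated logarithm. At each of the four corners the two branches differ by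
`πi/2`, and these jumps add up to `2πi`. -/
theorem rectIntegral_inv_sub_of_mem {x₀ x₁ y₀ y₁ : ℝ} {r : ℂ}
    (hr : r ∈ Ioo x₀ x₁ ×ℂ Ioo y₀ y₁) :
    rectIntegral (fun z => (z - r)⁻¹) x₀ x₁ y₀ y₁ = 2 * Real.pi * Complex.I := by
  obtain ⟨⟨hx₀, hx₁⟩, hy₀, hy₁⟩ := hr
  have hx : x₀ ≤ x₁ := (hx₀.trans hx₁).le
  have hy : y₀ ≤ y₁ := (hy₀.trans hy₁).le
  have hbot := integral_inv_segment hx (y₀ * Complex.I - r) 1 Complex.I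
    (fun s _ => by simp; linarith)
  have htop := integral_inv_segment hx (y₁ * Complex.I - r) 1 (-Complex.I)
    (fun s _ => by simp; linarith)
  have hright := integral_inv_segment hy (x₁ - r) Complex.I 1 (fun s _ => by simp; linarith)
  have hleft := integral_inv_segment hy (x₀ - r) Complex.I (-1) (fun s _ => by simp; linarith)
  have e₁ := log_I_mul (q := y₀ * Complex.I - r + x₁ * 1) (by simp; linarith)
  have e₂ := log_I_mul (q := -Complex.I * (y₁ * Complex.I - r + x₁ * 1)) (by simp; linarith)
  have e₃ := log_I_mul (q := -1 * (x₀ - r + y₁ * Complex.I)) (by simp; linarith)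
  have e₄ := log_I_mul (q := Complex.I * (y₀ * Complex.I - r + x₀ * 1)) (by simp; linarith)
  have s₁ : (x₁ - r + y₀ * Complex.I : ℂ) = y₀ * Complex.I - r + x₁ * 1 := by ring
  have s₂ : (x₁ - r + y₁ * Complex.I : ℂ) =
      Complex.I * (-Complex.I * (y₁ * Complex.I - r + x₁ * 1)) := by
    rw [← mul_assoc, mul_neg, Complex.I_mul_I]; ring
  have s₃ : -Complex.I * (y₁ * Complex.I - r + x₀ * 1) =
      Complex.I * (-1 * (x₀ - r + y₁ * Complex.I)) := by ring
  have s₄ : -1 * (x₀ - r + y₀ * Complex.I) =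
      Complex.I * (Complex.I * (y₀ * Complex.I - r + x₀ * 1)) := by
    rw [← mul_assoc, Complex.I_mul_I]; ring
  rw [one_mul, one_mul, s₁, s₂, e₂] at hright
  rw [s₄, e₄] at hleft
  rw [e₁] at hbot
  rw [s₃, e₃] at htop
  have i₁ : ∫ x : ℝ in x₀..x₁, ((x : ℂ) + y₀ * Complex.I - r)⁻¹ =
      ∫ s : ℝ in x₀..x₁, (y₀ * Complex.I - r + s * 1)⁻¹ * 1 := by
    congr 1; ext s; rw [mul_one, mul_one]; congr 1; ring
  have i₂ : ∫ x : ℝ in x₀..x₁, ((x : ℂ) + y₁ * Complex.I - r)⁻¹ =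
      ∫ s : ℝ in x₀..x₁, (y₁ * Complex.I - r + s * 1)⁻¹ * 1 := by
    congr 1; ext s; rw [mul_one, mul_one]; congr 1; ring
  have i₃ (x : ℝ) : Complex.I • ∫ y : ℝ in y₀..y₁, ((x : ℂ) + y * Complex.I - r)⁻¹ =
      ∫ s : ℝ in y₀..y₁, (x - r + s * Complex.I)⁻¹ * Complex.I := by
    rw [intervalIntegral.integral_mul_const, smul_eq_mul, mul_comm]
    congr 2; ext s; congr 1; ring
  rw [rectIntegral, i₁, i₂, i₃, i₃, hbot, htop, hright, hleft]
  ring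

theorem rectIntegral_inv_sub_of_notMem {x₀ x₁ y₀ y₁ : ℝ} (hx : x₀ ≤ x₁) (hy : y₀ ≤ y₁) {r : ℂ}
    (hr : r ∉ Icc x₀ x₁ ×ℂ Icc y₀ y₁) :
    rectIntegral (fun z => (z - r)⁻¹) x₀ x₁ y₀ y₁ = 0 := by
  refine Complex.integral_boundary_rect_eq_zero_of_differentiableOn (fun z => (z - r)⁻¹)
    ⟨x₀, y₀⟩ ⟨x₁, y₁⟩ ?_
  simp only [uIcc_of_le hx, uIcc_of_le hy]
  refine DifferentiableOn.inv (by fun_prop) fun z hz h0 => hr ?_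
  rwa [← sub_eq_zero.1 h0]

/-- The order is bottom, top, right, left. All parameters increase; the negative weights supply the
orientation of the top and left sides. -/
theorem countsPoints_rect {x₀ x₁ y₀ y₁ : ℝ} (hx : x₀ ≤ x₁) (hy : y₀ ≤ y₁) :
    CountsPoints (ι := Fin 4) ![x₀, x₀, y₀, y₀] ![x₁, x₁, y₁, y₁]
      ![fun x => x + y₀ * Complex.I, fun x => x + y₁ * Complex.I, fun y => x₁ + y * Complex.I,
        fun y => x₀ + y * Complex.I]
      ![fun _ => 1, fun _ => -1, fun _ => Complex.I, fun _ => -Complex.I]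
      (Ioo x₀ x₁ ×ℂ Ioo y₀ y₁) where
  le i := by fin_cases i <;> simpa
  continuousOn i := by fin_cases i <;> simp <;> fun_prop
  integrableOn i := by fin_cases i <;> simp
  null i := by
    refine volume_image_Icc_eq_zero ?_
    have h : Differentiable ℝ ((↑) : ℝ → ℂ) := Complex.ofRealCLM.differentiable
    fin_cases i <;> simp <;> fun_prop
  index r hr := by
    have hsum : rectIntegral (fun z => (z - r)⁻¹) x₀ x₁ y₀ y₁ =
        2 * Real.pi * Complex.I * (Ioo x₀ x₁ ×ℂ Ioo y₀ y₁).indicator 1 r := by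
      by_cases hin : r ∈ Ioo x₀ x₁ ×ℂ Ioo y₀ y₁
      · rw [rectIntegral_inv_sub_of_mem hin, indicator_of_mem hin, Pi.one_apply, mul_one]
      rw [indicator_of_notMem hin, mul_zero]
      refine rectIntegral_inv_sub_of_notMem hx hy fun hcl => ?_
      obtain ⟨⟨hx₀, hx₁⟩, hy₀, hy₁⟩ := hcl
      refine hr (mem_iUnion.2 ?_)
      rcases hx₀.eq_or_lt with h | hx₀'
      · exact ⟨3, r.im, ⟨hy₀, hy₁⟩, by rw [h]; exact r.re_add_im⟩
      rcases hx₁.eq_or_lt with h | hx₁'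
      · exact ⟨2, r.im, ⟨hy₀, hy₁⟩, by rw [← h]; exact r.re_add_im⟩
      rcases hy₀.eq_or_lt with h | hy₀'
      · exact ⟨0, r.re, ⟨hx₀, hx₁⟩, by rw [h]; exact r.re_add_im⟩
      rcases hy₁.eq_or_lt with h | hy₁'
      · exact ⟨1, r.re, ⟨hx₀, hx₁⟩, by rw [← h]; exact r.re_add_im⟩
      exact absurd ⟨⟨hx₀', hx₁'⟩, hy₀', hy₁'⟩ hin
    rw [← hsum, rectIntegral]
    simp [Fin.sum_univ_four, mul_comm]
    ring

/-! ### The density of zeros -/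

theorem kernelDeriv_one_one_self (z : ℂ) :
    kernelDeriv φ 1 1 z z = ((∑ j, ‖(derivative (φ j)).eval z‖ ^ 2 : ℝ) : ℂ) := by
  simp [kernelDeriv, Complex.mul_conj']

theorem zeroDensity_formula_eq_ofReal (z : ℂ) :
    (kernel φ z z * kernelDeriv φ 1 1 z z - (‖kernelDeriv φ 0 1 z z‖ : ℂ) ^ 2) /
        ((Real.pi : ℂ) * kernel φ z z ^ 2) =
      (((∑ j, ‖(φ j).eval z‖ ^ 2) * (∑ j, ‖(derivative (φ j)).eval z‖ ^ 2) -
        ‖kernelDeriv φ 0 1 z z‖ ^ 2) / (Real.pi * (∑ j, ‖(φ j).eval z‖ ^ 2) ^ 2) : ℝ) := by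
  rw [kernel_self, kernelDeriv_one_one_self]
  push_cast
  rfl

theorem zeroDensity_eq (z : ℂ) : zeroDensity φ z =
    ((∑ j, ‖(φ j).eval z‖ ^ 2) * (∑ j, ‖(derivative (φ j)).eval z‖ ^ 2) -
        ‖kernelDeriv φ 0 1 z z‖ ^ 2) / (Real.pi * (∑ j, ‖(φ j).eval z‖ ^ 2) ^ 2) := by
  rw [zeroDensity, Complex.ofReal_pow, zeroDensity_formula_eq_ofReal, Complex.ofReal_re]

theorem ofReal_zeroDensity (z : ℂ) : (zeroDensity φ z : ℂ) =
    (kernel φ z z * kernelDeriv φ 1 1 z z - (‖kernelDeriv φ 0 1 z z‖ : ℂ) ^ 2) /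
      ((Real.pi : ℂ) * kernel φ z z ^ 2) := by
  rw [zeroDensity_formula_eq_ofReal, zeroDensity_eq]

/-- Cauchy–Schwarz for the vectors `φ_j(z)` and `φ_j'(z)`. -/
theorem zeroDensity_nonneg (z : ℂ) : 0 ≤ zeroDensity φ z := by
  rw [zeroDensity_eq]
  refine div_nonneg (sub_nonneg.2 ?_) (by positivity)
  refine le_trans ?_ (Finset.sum_mul_sq_le_sq_mul_sq Finset.univ (fun j => ‖(φ j).eval z‖)
    fun j => ‖(derivative (φ j)).eval z‖)
  gcongr
  refine (norm_sum_le _ _).trans_eq ?_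
  simp

theorem continuous_zeroDensity (hφ0 : φ 0 = 1) : Continuous (zeroDensity φ) := by
  have h : Continuous fun z => kernelDeriv φ 0 1 z z := by
    unfold kernelDeriv
    fun_prop
  simp only [funext (zeroDensity_eq φ)]
  refine Continuous.div (by fun_prop) (by fun_prop) fun z => ?_
  have := sum_sq_pos φ hφ0 z
  positivity

/-- Twice `I` times the Wirtinger derivative `∂f/∂z̄`. -/
noncomputable def dbar (f : ℂ → ℂ) (z : ℂ) : ℂ :=
  Complex.I • fderiv ℝ f z 1 - fderiv ℝ f z Complex.I

theorem dbar_mul {f g : ℂ → ℂ} {z : ℂ} (hf : DifferentiableAt ℝ f z)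
    (hg : DifferentiableAt ℝ g z) :
    dbar (fun z => f z * g z) z = f z * dbar g z + g z * dbar f z := by
  simp only [dbar, fderiv_fun_mul hf hg, add_apply,
    smul_apply, smul_eq_mul]
  ring

/-- `∂/∂z̄` kills the holomorphic factor and differentiates only the conjugate one. Stated for two
families so as to cover both `K` and `conj K^{(0,1)}`. -/
theorem hasFDerivAt_sum_mul_conj {ι : Type*} [Fintype ι] (p q : ι → ℂ[X]) (z : ℂ) :
    ∃ L : ℂ →L[ℝ] ℂ, HasFDerivAt (fun z => ∑ j, (p j).eval z * conj ((q j).eval z)) L z ∧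
      Complex.I • L 1 - L Complex.I =
        2 * Complex.I * ∑ j, (p j).eval z * conj ((derivative (q j)).eval z) := by
  have hp (p : ℂ[X]) := (p.hasDerivAt z).complexToReal_fderiv
  have hc (j : ι) : HasFDerivAt (fun z => conj ((q j).eval z)) _ z :=
    Complex.conjCLE.toContinuousLinearMap.hasFDerivAt.comp z (hp (q j))
  refine ⟨_, HasFDerivAt.fun_sum fun j _ => (hp (p j)).mul (hc j), ?_⟩
  simp only [sum_apply, smul_eq_mul, Finset.mul_sum,
    ← Finset.sum_sub_distrib]
  refine Finset.sum_congr rfl fun j _ => ?_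
  simp
  ring

theorem differentiableAt_kernel_self (z : ℂ) :
    DifferentiableAt ℝ (fun z => kernel φ z z) z :=
  let ⟨_, h, _⟩ := hasFDerivAt_sum_mul_conj φ φ z
  h.differentiableAt

theorem dbar_kernel_self (z : ℂ) :
    dbar (fun z => kernel φ z z) z = 2 * Complex.I * kernelDeriv φ 0 1 z z := by
  obtain ⟨L, h, hL⟩ := hasFDerivAt_sum_mul_conj φ φ z
  rw [dbar, show fderiv ℝ (fun z => kernel φ z z) z = L from h.fderiv, hL]
  rfl

theorem conj_kernelDeriv_zero_one (z : ℂ) : conj (kernelDeriv φ 0 1 z z) =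
    ∑ j, (derivative (φ j)).eval z * conj ((φ j).eval z) := by
  simp [kernelDeriv, map_sum, mul_comm]

theorem differentiableAt_conj_kernelDeriv (z : ℂ) :
    DifferentiableAt ℝ (fun z => conj (kernelDeriv φ 0 1 z z)) z := by
  obtain ⟨L, h, -⟩ := hasFDerivAt_sum_mul_conj (fun j => derivative (φ j)) φ z
  simpa only [conj_kernelDeriv_zero_one] using h.differentiableAt

theorem dbar_conj_kernelDeriv (z : ℂ) :
    dbar (fun z => conj (kernelDeriv φ 0 1 z z)) z =
      2 * Complex.I * kernelDeriv φ 1 1 z z := by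
  obtain ⟨L, h, hL⟩ := hasFDerivAt_sum_mul_conj (fun j => derivative (φ j)) φ z
  simp only [conj_kernelDeriv_zero_one]
  rw [dbar, h.fderiv, hL]
  rfl

theorem differentiable_meanLogDeriv (hφ0 : φ 0 = 1) : Differentiable ℝ (meanLogDeriv φ) :=
  fun z => by
    have h : meanLogDeriv φ = fun z => conj (kernelDeriv φ 0 1 z z) * (kernel φ z z)⁻¹ :=
      funext fun z => div_eq_mul_inv _ _
    rw [h]
    exact (differentiableAt_conj_kernelDeriv φ z).mul
      ((differentiableAt_kernel_self φ z).inv (kernel_self_ne_zero φ hφ0 z))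

/-- Applying `∂/∂z̄` to `m K = conj K^{(0,1)}` gives `m K^{(0,1)} + K ∂m/∂z̄ = K^{(1,1)}`, which is
solved for `∂m/∂z̄`. -/
theorem dbar_meanLogDeriv (hφ0 : φ 0 = 1) (z : ℂ) :
    dbar (meanLogDeriv φ) z = 2 * Real.pi * Complex.I * zeroDensity φ z := by
  have hK := kernel_self_ne_zero φ hφ0
  have h := dbar_mul (differentiable_meanLogDeriv φ hφ0 z) (differentiableAt_kernel_self φ z)
  have hfun : (fun z => meanLogDeriv φ z * kernel φ z z) =
      fun z => conj (kernelDeriv φ 0 1 z z) := by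
    ext z
    exact div_mul_cancel₀ _ (hK z)
  rw [hfun, dbar_conj_kernelDeriv, dbar_kernel_self] at h
  have hn : (‖kernelDeriv φ 0 1 z z‖ : ℂ) ^ 2 =
      conj (kernelDeriv φ 0 1 z z) * kernelDeriv φ 0 1 z z := (Complex.conj_mul' _).symm
  have hm : conj (kernelDeriv φ 0 1 z z) = meanLogDeriv φ z * kernel φ z z :=
    (congrFun hfun z).symm
  have hpi : (Real.pi : ℂ) ≠ 0 := by exact_mod_cast Real.pi_ne_zero
  have hKz := hK z
  rw [ofReal_zeroDensity, hn, hm]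
  field_simp
  linear_combination -h

/-- Green's theorem for the mean logarithmic derivative. -/
theorem rectIntegral_meanLogDeriv (hφ0 : φ 0 = 1) {x₀ x₁ y₀ y₁ : ℝ} (hx : x₀ ≤ x₁)
    (hy : y₀ ≤ y₁) :
    rectIntegral (meanLogDeriv φ) x₀ x₁ y₀ y₁ =
      2 * Real.pi * Complex.I * (∫ z in Ioo x₀ x₁ ×ℂ Ioo y₀ y₁, zeroDensity φ z : ℝ) := by
  have hρ := continuous_zeroDensity φ hφ0
  have hfun : (fun z => Complex.I • fderiv ℝ (meanLogDeriv φ) z 1 -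
      fderiv ℝ (meanLogDeriv φ) z Complex.I) =
      fun z => 2 * Real.pi * Complex.I * zeroDensity φ z := funext (dbar_meanLogDeriv φ hφ0)
  have h := Complex.integral_boundary_rect_of_differentiableOn_real (meanLogDeriv φ)
    ⟨x₀, y₀⟩ ⟨x₁, y₁⟩ (differentiable_meanLogDeriv φ hφ0).differentiableOn (by
      rw [hfun]
      refine ContinuousOn.integrableOn_compact ?_ (by fun_prop)
      exact isCompact_uIcc.reProdIm isCompact_uIcc)
  refine h.trans ?_
  simp only [fun z => congrFun hfun z]
  simp only [intervalIntegral.integral_const_mul, intervalIntegral.integral_ofReal]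
  congr 2
  have hpre : Complex.measurableEquivRealProd.symm ⁻¹' (Ioo x₀ x₁ ×ℂ Ioo y₀ y₁) =
      Ioo x₀ x₁ ×ˢ Ioo y₀ y₁ := rfl
  rw [← Complex.volume_preserving_equiv_real_prod.symm.setIntegral_preimage_emb
    (MeasurableEquiv.measurableEmbedding _), hpre, Measure.volume_eq_prod, setIntegral_prod]
  · rw [intervalIntegral.integral_of_le hx, integral_Ioc_eq_integral_Ioo]
    refine setIntegral_congr_fun measurableSet_Ioo fun x _ => ?_
    rw [intervalIntegral.integral_of_le hy, integral_Ioc_eq_integral_Ioo]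
    refine setIntegral_congr_fun measurableSet_Ioo fun y _ => ?_
    rw [← Complex.mk_eq_add_mul_I]
    rfl
  · refine IntegrableOn.mono_set (t := Icc x₀ x₁ ×ˢ Icc y₀ y₁) ?_
      (prod_mono Ioo_subset_Icc_self Ioo_subset_Icc_self)
    refine ContinuousOn.integrableOn_compact (isCompact_Icc.prod isCompact_Icc) ?_
    have : Continuous Complex.measurableEquivRealProd.symm :=
      Complex.equivRealProdCLM.symm.continuous
    fun_prop

theorem integrableOn_zeroDensity_rect (hφ0 : φ 0 = 1) (x₀ x₁ y₀ y₁ : ℝ) :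
    IntegrableOn (zeroDensity φ) (Ioo x₀ x₁ ×ℂ Ioo y₀ y₁) := by
  refine IntegrableOn.mono_set (t := Icc x₀ x₁ ×ℂ Icc y₀ y₁) ?_
    fun z hz => ⟨Ioo_subset_Icc_self hz.1, Ioo_subset_Icc_self hz.2⟩
  exact (continuous_zeroDensity φ hφ0).continuousOn.integrableOn_compact
    (isCompact_Icc.reProdIm isCompact_Icc)

/-! ### The mean number of zeros in a Borel set -/

/-- The number of zeros in `S` is measurable, with mean `∫⁻ z in S, ρ z`. -/
def HasZeroDensity (S : Set ℂ) : Prop :=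
  AEMeasurable (fun c => (zeroCount (combination φ c) S : ℝ≥0∞)) (coeffLaw (n + 1)) ∧
    ∫⁻ c, zeroCount (combination φ c) S ∂coeffLaw (n + 1) =
      ∫⁻ z in S, ENNReal.ofReal (zeroDensity φ z)

theorem integrable_ofReal_zeroCount {S : Set ℂ}
    (h : Integrable (fun c => (zeroCount (combination φ c) S : ℂ)) (coeffLaw (n + 1))) :
    Integrable (fun c => (zeroCount (combination φ c) S : ℝ)) (coeffLaw (n + 1)) := by
  simpa using h.re

/-- The boundary integral of `m` is evaluated twice: by counting zeros and by Green's theorem. -/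
theorem hasZeroDensity_rect (hφ0 : φ 0 = 1) {x₀ x₁ y₀ y₁ : ℝ} (hx : x₀ ≤ x₁) (hy : y₀ ≤ y₁) :
    HasZeroDensity φ (Ioo x₀ x₁ ×ℂ Ioo y₀ y₁) := by
  have h := countsPoints_rect hx hy
  have hint := integrable_ofReal_zeroCount φ (h.integrable_zeroCount φ hφ0)
  have hmean := h.integral_zeroCount φ hφ0
  set R := Ioo x₀ x₁ ×ℂ Ioo y₀ y₁
  have hsum : ∫ c, (zeroCount (combination φ c) R : ℝ) ∂coeffLaw (n + 1) =
      ∫ z in R, zeroDensity φ z := by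
    have h1 : ∫ c, (zeroCount (combination φ c) R : ℂ) ∂coeffLaw (n + 1) =
        ((∫ c, (zeroCount (combination φ c) R : ℝ) ∂coeffLaw (n + 1) : ℝ) : ℂ) := by
      rw [← integral_complex_ofReal]
      simp
    have h2 := rectIntegral_meanLogDeriv φ hφ0 hx hy
    rw [h1] at hmean
    refine Complex.ofReal_injective (hmean.trans ?_)
    rw [one_div, inv_mul_eq_iff_eq_mul₀ Complex.two_pi_I_ne_zero, ← h2, rectIntegral]
    simp [Fin.sum_univ_four, mul_comm]
    ring
  refine ⟨?_, ?_⟩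
  · have := hint.aestronglyMeasurable.aemeasurable.ennreal_ofReal
    simpa using this
  · have e1 := ofReal_integral_eq_lintegral_ofReal hint (Eventually.of_forall fun c => by positivity)
    have e2 := ofReal_integral_eq_lintegral_ofReal
      (integrableOn_zeroDensity_rect φ hφ0 x₀ x₁ y₀ y₁)
      (Eventually.of_forall (zeroDensity_nonneg φ))
    rw [hsum] at e1
    simpa using e1.symm.trans e2

/-- The sum of the Dirac masses at the zeros of `p`. -/
noncomputable def zeroMeasure (p : ℂ[X]) : Measure ℂ :=
  (p.roots.map Measure.dirac).sum

theorem zeroMeasure_apply (p : ℂ[X]) {S : Set ℂ} (hS : MeasurableSet S) :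
    zeroMeasure p S = zeroCount p S := by
  classical
  unfold zeroCount zeroMeasure
  induction p.roots using Multiset.induction_on with
  | empty => simp
  | cons r R ih =>
    rw [Multiset.map_cons, Multiset.sum_cons, Measure.add_apply, ih, Measure.dirac_apply' _ hS,
      Multiset.countP_cons]
    by_cases hr : r ∈ S <;> simp [hr, add_comm]

/-- The deterministic bound behind every finiteness claim. It also covers the zero polynomial, whose
multiset of roots is empty. -/
theorem zeroCount_combination_le (hφdeg : ∀ j, (φ j).degree = (j : ℕ)) (c : Fin (n + 1) → ℂ)
    (S : Set ℂ) : zeroCount (combination φ c) S ≤ n := by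
  classical
  unfold zeroCount
  refine (Multiset.countP_le_card _ _).trans ((card_roots' _).trans ?_)
  refine natDegree_sum_le_of_forall_le _ _ fun j _ => (natDegree_C_mul_le _ _).trans ?_
  rw [natDegree_eq_of_degree_eq_some (hφdeg j)]
  exact Nat.lt_succ_iff.1 j.2

theorem lintegral_zeroCount_lt_top (hφdeg : ∀ j, (φ j).degree = (j : ℕ)) (S : Set ℂ) :
    ∫⁻ c, zeroCount (combination φ c) S ∂coeffLaw (n + 1) < ∞ := by
  calc ∫⁻ c, (zeroCount (combination φ c) S : ℝ≥0∞) ∂coeffLaw (n + 1)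
      ≤ ∫⁻ _, (n : ℝ≥0∞) ∂coeffLaw (n + 1) :=
        lintegral_mono fun c => Nat.mono_cast (zeroCount_combination_le φ hφdeg c S)
    _ < ∞ := by simp

theorem HasZeroDensity.iUnion_of_monotone {S : ℕ → Set ℂ} (hS : ∀ k, MeasurableSet (S k))
    (hmono : Monotone S) (h : ∀ k, HasZeroDensity φ (S k)) : HasZeroDensity φ (⋃ k, S k) := by
  have heq (c : Fin (n + 1) → ℂ) : (zeroCount (combination φ c) (⋃ k, S k) : ℝ≥0∞) =
      ⨆ k, (zeroCount (combination φ c) (S k) : ℝ≥0∞) := by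
    rw [← zeroMeasure_apply _ (MeasurableSet.iUnion hS), hmono.measure_iUnion]
    simp only [zeroMeasure_apply _ (hS _)]
  have hρ : ∫⁻ z in ⋃ k, S k, ENNReal.ofReal (zeroDensity φ z) =
      ⨆ k, ∫⁻ z in S k, ENNReal.ofReal (zeroDensity φ z) := by
    have := hmono.measure_iUnion
      (μ := volume.withDensity fun z => ENNReal.ofReal (zeroDensity φ z))
    simpa only [withDensity_apply _ (MeasurableSet.iUnion hS), withDensity_apply _ (hS _)]
      using this
  refine ⟨?_, ?_⟩
  · simp only [heq]
    exact AEMeasurable.iSup fun k => (h k).1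
  · simp only [heq]
    rw [lintegral_iSup' (fun k => (h k).1), hρ]
    · simp only [(h _).2]
    · refine Eventually.of_forall fun c k l hkl => ?_
      simp only [← zeroMeasure_apply _ (hS _)]
      exact measure_mono (hmono hkl)

/-- Exhaustion by squares; the whole plane is needed before complements can be taken. -/
theorem hasZeroDensity_univ (hφ0 : φ 0 = 1) : HasZeroDensity φ univ := by
  have hU : ⋃ k : ℕ, Ioo (-k : ℝ) k ×ℂ Ioo (-k : ℝ) k = univ := by
    refine eq_univ_of_forall fun z => mem_iUnion.2 ?_
    obtain ⟨k, hk⟩ := exists_nat_gt ‖z‖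
    exact ⟨k, abs_lt.1 ((Complex.abs_re_le_norm z).trans_lt hk),
      abs_lt.1 ((Complex.abs_im_le_norm z).trans_lt hk)⟩
  rw [← hU]
  refine HasZeroDensity.iUnion_of_monotone φ (fun k => ?_) (fun k l hkl z hz => ?_) fun k => ?_
  · exact (isOpen_Ioo.reProdIm isOpen_Ioo).measurableSet
  · have : (k : ℝ) ≤ l := by exact_mod_cast hkl
    exact ⟨Ioo_subset_Ioo (by linarith) this hz.1, Ioo_subset_Ioo (by linarith) this hz.2⟩
  · have : (-k : ℝ) ≤ k := by linarith [Nat.cast_nonneg (α := ℝ) k]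
    exact hasZeroDensity_rect φ hφ0 this this

theorem HasZeroDensity.compl (hφ0 : φ 0 = 1) (hφdeg : ∀ j, (φ j).degree = (j : ℕ)) {S : Set ℂ}
    (hS : MeasurableSet S) (h : HasZeroDensity φ S) : HasZeroDensity φ Sᶜ := by
  have hU := hasZeroDensity_univ φ hφ0
  have heq (c : Fin (n + 1) → ℂ) : (zeroCount (combination φ c) Sᶜ : ℝ≥0∞) =
      zeroCount (combination φ c) univ - zeroCount (combination φ c) S := by
    simp only [← zeroMeasure_apply _ hS.compl, ← zeroMeasure_apply _ hS,
      ← zeroMeasure_apply _ MeasurableSet.univ]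
    refine measure_compl hS ?_
    rw [zeroMeasure_apply _ hS]
    exact ENNReal.natCast_ne_top _
  refine ⟨?_, ?_⟩
  · simp only [heq]
    exact hU.1.sub h.1
  · simp only [heq]
    rw [lintegral_sub' h.1 (lintegral_zeroCount_lt_top φ hφdeg S).ne, hU.2, h.2,
      setLIntegral_compl hS, setLIntegral_univ]
    · rw [← h.2]
      exact (lintegral_zeroCount_lt_top φ hφdeg S).ne
    · refine Eventually.of_forall fun c => ?_
      simp only [← zeroMeasure_apply _ hS, ← zeroMeasure_apply _ MeasurableSet.univ]
      exact measure_mono (subset_univ S)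

theorem HasZeroDensity.iUnion {S : ℕ → Set ℂ} (hS : ∀ k, MeasurableSet (S k))
    (hdisj : Pairwise (Function.onFun Disjoint S)) (h : ∀ k, HasZeroDensity φ (S k)) :
    HasZeroDensity φ (⋃ k, S k) := by
  have heq (c : Fin (n + 1) → ℂ) : (zeroCount (combination φ c) (⋃ k, S k) : ℝ≥0∞) =
      ∑' k, (zeroCount (combination φ c) (S k) : ℝ≥0∞) := by
    rw [← zeroMeasure_apply _ (MeasurableSet.iUnion hS), measure_iUnion hdisj hS]
    simp only [zeroMeasure_apply _ (hS _)]
  refine ⟨?_, ?_⟩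
  · simp only [heq]
    exact AEMeasurable.tsum fun k => (h k).1
  · simp only [heq]
    rw [lintegral_tsum fun k => (h k).1, lintegral_iUnion hS hdisj]
    simp only [(h _).2]

/-- The mean number of zeros in any Borel set is the integral of the density. -/
theorem hasZeroDensity (hφ0 : φ 0 = 1) (hφdeg : ∀ j, (φ j).degree = (j : ℕ)) {S : Set ℂ}
    (hS : MeasurableSet S) : HasZeroDensity φ S := by
  set e := Complex.measurableEquivRealProd
  suffices h : ∀ A : Set (ℝ × ℝ), MeasurableSet A → HasZeroDensity φ (e ⁻¹' A) by
    have := h (e.symm ⁻¹' S) (e.symm.measurable hS)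
    rwa [← preimage_comp, e.symm_comp_self, preimage_id] at this
  have hspan := (Real.finiteSpanningSetsInIooRat volume).isCountablySpanning
  have hgen : MeasurableSpace.generateFrom (⋃ (a : ℚ) (b : ℚ) (_ : a < b), {Ioo (a : ℝ) (b : ℝ)}) =
      Real.measurableSpace := Real.borel_eq_generateFrom_Ioo_rat.symm
  intro A hA
  -- Products of rational open intervals form a π-system generating the Borel sets of the plane.
  induction A, hA using MeasurableSpace.induction_on_inter
    (generateFrom_eq_prod hgen hgen hspan hspan).symm
    (Real.isPiSystem_Ioo_rat.prod Real.isPiSystem_Ioo_rat) with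
  | empty =>
    have h0 (c : Fin (n + 1) → ℂ) : zeroCount (combination φ c) ∅ = 0 := by
      simp [zeroCount]
    simp [HasZeroDensity, h0]
  | basic A hA =>
    obtain ⟨I, hI, J, hJ, rfl⟩ := hA
    simp only [mem_iUnion, mem_singleton_iff] at hI hJ
    obtain ⟨a, b, hab, rfl⟩ := hI
    obtain ⟨c, d, hcd, rfl⟩ := hJ
    exact hasZeroDensity_rect φ hφ0 (by exact_mod_cast hab.le) (by exact_mod_cast hcd.le)
  | compl A hA ih => exact ih.compl φ hφ0 hφdeg (e.measurable hA)
  | iUnion A hdisj hA ih =>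
    rw [preimage_iUnion]
    exact HasZeroDensity.iUnion φ (fun k => e.measurable (hA k))
      (fun k l hkl => (hdisj hkl).preimage e) ih

theorem integrable_zeroCount (hφ0 : φ 0 = 1) (hφdeg : ∀ j, (φ j).degree = (j : ℕ)) {S : Set ℂ}
    (hS : MeasurableSet S) :
    Integrable (fun c => (zeroCount (combination φ c) S : ℝ)) (coeffLaw (n + 1)) := by
  have hm := (hasZeroDensity φ hφ0 hφdeg hS).1.ennreal_toReal
  simp only [ENNReal.toReal_natCast] at hm
  refine Integrable.of_bound hm.aestronglyMeasurable (n : ℝ) (Eventually.of_forall fun c => ?_)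
  simpa using zeroCount_combination_le φ hφdeg c S

theorem integrableOn_zeroDensity (hφ0 : φ 0 = 1) (hφdeg : ∀ j, (φ j).degree = (j : ℕ))
    {S : Set ℂ} (hS : MeasurableSet S) : IntegrableOn (zeroDensity φ) S := by
  refine ⟨(continuous_zeroDensity φ hφ0).aestronglyMeasurable, ?_⟩
  rw [hasFiniteIntegral_iff_ofReal (Eventually.of_forall (zeroDensity_nonneg φ)),
    ← (hasZeroDensity φ hφ0 hφdeg hS).2]
  exact lintegral_zeroCount_lt_top φ hφdeg S

theorem integral_zeroCount (hφ0 : φ 0 = 1) (hφdeg : ∀ j, (φ j).degree = (j : ℕ)) {S : Set ℂ}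
    (hS : MeasurableSet S) :
    ∫ c, (zeroCount (combination φ c) S : ℝ) ∂coeffLaw (n + 1) = ∫ z in S, zeroDensity φ z := by
  rw [integral_eq_lintegral_of_nonneg_ae (Eventually.of_forall fun c => by positivity)
      (integrable_zeroCount φ hφ0 hφdeg hS).aestronglyMeasurable,
    integral_eq_lintegral_of_nonneg_ae (Eventually.of_forall (zeroDensity_nonneg φ))
      (continuous_zeroDensity φ hφ0).aestronglyMeasurable,
    ← (hasZeroDensity φ hφ0 hφdeg hS).2]
  simp

/-! ### Transfer to an arbitrary probability space -/

theorem map_eq_coeffLaw {Ω : Type*} [MeasurableSpace Ω] {P : Measure Ω} [IsProbabilityMeasure P]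
    {m : ℕ} {η : Fin m → Ω → ℂ} (hlaw : ∀ j, HasLaw (η j) stdComplexNormal P)
    (hindep : iIndepFun η P) : P.map (fun ω j => η j ω) = coeffLaw m := by
  rw [(iIndepFun_iff_map_fun_eq_pi_map fun j => (hlaw j).aemeasurable).1 hindep, coeffLaw]
  congr 1
  ext1 j
  exact (hlaw j).map_eq

end RandomZeros

theorem corollary1p5
    {Ω : Type*} [MeasurableSpace Ω] (P : Measure Ω) [IsProbabilityMeasure P]
    (n : ℕ) (φ : Fin (n + 1) → ℂ[X])
    (hφ0 : φ 0 = 1) (hφdeg : ∀ j, (φ j).degree = (j : ℕ))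
    (η : Fin (n + 1) → Ω → ℂ)
    (hlaw : ∀ j, HasLaw (η j) RandomZeros.stdComplexNormal P)
    (hindep : iIndepFun η P)
    (Θ : Set ℂ) (hΘ_open : IsOpen Θ) (hΘ_conn : IsConnected Θ) :
    -- the number of zeros in `Θ` has a finite mean
    Integrable
      (fun ω => (RandomZeros.zeroCount
        (RandomZeros.combination φ (fun j => η j ω)) Θ : ℝ)) P ∧
    -- the mean as a contour integral, whenever `∂Θ` is a contour
    (∀ (k : ℕ) (γ : Fin k → RandomZeros.ClosedPath), RandomZeros.IsPositiveBoundary γ Θ →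
      ((∫ ω, (RandomZeros.zeroCount
          (RandomZeros.combination φ (fun j => η j ω)) Θ : ℝ) ∂P : ℝ) : ℂ) =
        1 / (2 * Real.pi * Complex.I) *
          ∑ i, (γ i).contourIntegral (fun z =>
            conj (RandomZeros.kernelDeriv φ 0 1 z z) / RandomZeros.kernel φ z z)) ∧
    -- the mean as an area integral
    IntegrableOn (RandomZeros.zeroDensity φ) Θ volume ∧
    (∫ ω, (RandomZeros.zeroCount
        (RandomZeros.combination φ (fun j => η j ω)) Θ : ℝ) ∂P) =
      ∫ z in Θ, RandomZeros.zeroDensity φ z ∧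
    -- the density is real and given by the stated formula, whose denominator does not vanish
    (∀ z : ℂ, RandomZeros.kernel φ z z ≠ 0 ∧
      (RandomZeros.zeroDensity φ z : ℂ) =
        (RandomZeros.kernel φ z z * RandomZeros.kernelDeriv φ 1 1 z z
            - (‖RandomZeros.kernelDeriv φ 0 1 z z‖ : ℂ) ^ 2) /
          ((Real.pi : ℂ) * RandomZeros.kernel φ z z ^ 2)) := by
  have hmap := RandomZeros.map_eq_coeffLaw hlaw hindep
  have hη : AEMeasurable (fun ω j => η j ω) P :=
    aemeasurable_pi_lambda _ fun j => (hlaw j).aemeasurable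
  have hΘ := hΘ_open.measurableSet
  have hint := RandomZeros.integrable_zeroCount φ hφ0 hφdeg hΘ
  have hmean : ∫ ω, (RandomZeros.zeroCount
      (RandomZeros.combination φ (fun j => η j ω)) Θ : ℝ) ∂P =
      ∫ c, (RandomZeros.zeroCount (RandomZeros.combination φ c) Θ : ℝ)
        ∂(RandomZeros.coeffLaw (n + 1)) := by
    rw [← hmap] at hint ⊢
    exact (integral_map hη hint.aestronglyMeasurable).symm
  refine ⟨?_, fun k γ hγ => ?_, RandomZeros.integrableOn_zeroDensity φ hφ0 hφdeg hΘ, ?_,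
    fun z => ⟨RandomZeros.kernel_self_ne_zero φ hφ0 z, RandomZeros.ofReal_zeroDensity φ z⟩⟩
  · rw [← hmap] at hint
    exact hint.comp_aemeasurable hη
  -- The contour formula comes from the given cycle itself, without passing through the area
  -- formula.
  · rw [hmean, ← integral_complex_ofReal]
    simp only [Complex.ofReal_natCast]
    exact (hγ.countsPoints hΘ_open).integral_zeroCount φ hφ0
  · rw [hmean, RandomZeros.integral_zeroCount φ hφ0 hφdeg hΘ]
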